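/- **Setting.** A graph on $[n]$ is a set $E\subseteq[n]\times[n]$ of directed edges; let $E'=E\cup\{(i,i): i\in[n]\}$ (the loop $(i,i)$ represents node $i$). An equivalence class $\mu$ (resp. $\lambda$) of index tuples $(\mathbf i,\mathbf j)\in[n]^{2}\times[n]^2$ (resp. $\mathbf j\in[n]^2$) is the set of all tuples with a given equality pattern, i.e. a partition of the positions, regardless of $n$. Put $\mathbf B^\mu_{\mathbf i,\mathbf j}=1$ if $(\mathbf i,\mathbf j)\in\mu$ and $0$ otherwise, and $\mathbf C^\lambda_{\mathbf j}=1$ if $\mathbf j\in\lambda$ and $0$ otherwise. A sparse lightweight linear layer maps $\mathbf A$ to $$\bar L(\mathbf A)_{\mathbf j}=\sum_{\mu\in\mathcal M}\sum_{\mathbf i\in E'}\mathbf B^\mu_{\mathbf i,\mathbf j}\mathbf A_{\mathbf i}w_\mu+\sum_\lambda \mathbf C^\lambda_{\mathbf j}b_\lambda\quad(\mathbf j\in E'),\qquad \bar L(\mathbf A)_{\mathbf j}=0\quad(\mathbf j\notin E'),$$ where $\mathcal M$ is the set of classes in which every entry of $\mathbf i$ equals some entry of $\mathbf j$. Fix $d_H\ge1$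 and a kernel feature map $\phi:\mathbb R^{d_H}\to[0,\infty)^{d_K}$ that is not identically zero. A sparse second-order Transformer layer with kernel attention $\mathrm{Enc}_{2\to2}$ of width $D$ maps $\mathbf A\in\mathbb R^{n\times n\times D}$ to $\mathrm{Attn}(\mathbf A)+\bar L^2(\mathrm{ReLU}(\bar L^1(\mathrm{Attn}(\mathbf A))))$, where $$\mathrm{Attn}(\mathbf A)_{\mathbf j}=\sum_{h=1}^H\sum_\mu\sum_{\mathbf i\in E'}\boldsymbol\alpha^{h,\mu}_{\mathbf i,\mathbf j}\mathbf A_{\mathbf i}w^V_{h,\mu}w^O_{h,\mu}\quad(\mathbf j\in E'),\qquad \mathrm{Attn}(\mathbf A)_{\mathbf j}=0\quad(\mathbf j\notin E'),$$ $$\boldsymbol\alpha^{h,\mu}_{\mathbf i,\mathbf j}=\mathbf B^\mu_{\mathbf i,\mathbf j}\,\phi(\mathbf Q^{h,\mu}_{\mathbf j})^\top\phi(\mathbf K^{h,\mu}_{\mathbf i})$$ (no normalization over the keys), $w^V_{h,\mu}\in\mathbb R^{D\times d_H}$, $w^O_{h,\mu}\in\mathbb R^{d_H\times D}$, and $\mathbf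 Q^{h,\mu},\mathbf K^{h,\mu}$ are sparse lightweight linear layers of $\mathbf A$ with $d_H$ output channels. In the normalized version, $\boldsymbol\alpha^{h,\mu}_{\mathbf i,\mathbf j}$ is divided by $\sum_{\mathbf i'\in E'}\mathbf B^\mu_{\mathbf i',\mathbf j}\phi(\mathbf Q^{h,\mu}_{\mathbf j})^\top\phi(\mathbf K^{h,\mu}_{\mathbf i'})$, with $0/0=0$. The parameters of a layer are the weights, the biases, the number $H$ of heads and the hidden dimension $d_F$ of the feedforward part; they depend neither on $n$ nor on the graph. Node features $\mathbf X\in\mathbb R^{n\times d_v}$ and edge features $\mathbf E\in\mathbb R^{n\times n\times d_e}$ are encoded, for some number $p$ of padding channels, as $\mathbf A\in\mathbb R^{n\times n\times(2d_v+d_e+p)}$, $\mathbf A_{ij}=(\mathbf X_i,\mathbf X_j,\mathbf E_{ij},0)$. A message passing step with message function $M$ and update function $U$ maps $(\mathbf X,\mathbf E)$ to $$\mathbf H_j=U\Bigl(\mathbf X_j,\ \sum_{i:(i,j)\in E}M(\mathbf X_j,\mathbf X_i,\mathbf E_{ij})\Bigr)\in\mathbb R^{d},\qquad j\in[n].$$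 **Theorem 2.** 1. Let $M:\mathbb R^{2d_v+d_e}\to\mathbb R^{d_m}$ and $U:\mathbb R^{d_v+d_m}\to\mathbb R^d$ be continuous, and let $N\in\mathbb N$, $r\in\mathbb R$, $\varepsilon>0$. Then there are $p$, the parameters of two (unnormalized) layers $\mathrm{Enc}^{(1)},\mathrm{Enc}^{(2)}$ of width $2d_v+d_e+p$, and $d$ distinct output channels such that, for all $n\le N$, all graphs without self-loops on $[n]$ and all $\mathbf X,\mathbf E$ with entries bounded by $r$ in absolute value, the vector $\mathrm{Enc}^{(2)}(\mathrm{Enc}^{(1)}(\mathbf A))_{jj}$, restricted to the output channels, differs from $\mathbf H_j$ by less than $\varepsilon$ in every coordinate, for every $j\in[n]$. The same holds (with other parameters) for the graphs that have a self-loop at every node. 2. Conversely, let $d_v\ge1$, $d_e\ge 0$ and $p\ge0$. There is a single layer $\mathrm{Enc}$ of width $2d_v+d_e+p$ such that for every $n$, every graph $E$ on $[n]$ and every $r>0$ there is $\delta>0$ with the following property. Let $d(E)\in\mathbb N\cup\{\infty\}$ be the largest directed distance between two nodes. If $T<d(E)$, then no $T$ successive message passing steps on $E$ (with arbitrary feature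 dimensions and arbitrary message and update functions in each step), followed by an arbitrary function applied at each node, approximate the node outputs $(\mathrm{Enc}(\mathbf A)_{jj})_{j\in[n]}$ with error less than $\delta$ in every coordinate for all $\mathbf X,\mathbf E$ with entries bounded by $r$ in absolute value. If $E$ has more than one connected component (edge directions ignored), then no number $T$ of message passing steps does so. This holds both for the unnormalized and for the normalized version of the layer. -/

import Mathlib

open Matrix

noncomputable section

namespace HOT

/-! Tensors, equality patterns, equivariant linear layers -/

/-- Order-`k` multi-indices over `n` nodes. -/
abbrev MIdx (k n : ℕ) : Type := Fin k → Fin n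

/-- Order-`k` tensors over `n` nodes with feature channels `C`. -/
abbrev Tensor (k n : ℕ) (C : Type) : Type := MIdx k n → C → ℝ

/-- Equality patterns of order-`(k + l)` multi-indices `(i, j)`: partitions of the `k + l` positions.
They label the equivalence classes `μ` independently of `n`. -/
abbrev PairPattern (k l : ℕ) : Type := Setoid (Fin k ⊕ Fin l)

instance finiteSetoid (α : Type) [Finite α] : Finite (Setoid α) :=
  Finite.of_injective (fun s : Setoid α => (s.r : α → α → Prop)) (by
    intro s t h
    exact Setoid.ext fun a b => iff_of_eq (congrFun (congrFun h a) b))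

instance fintypeSetoid (α : Type) [Finite α] : Fintype (Setoid α) := Fintype.ofFinite _

open Classical in
/-- The basis tensor of the weights: `1` if the joint multi-index `(i, j)` has equality pattern `μ`,
and `0` otherwise. -/
def basisB {k l n : ℕ} (μ : PairPattern k l) (i : MIdx k n) (j : MIdx l n) : ℝ :=
  if Setoid.ker (Sum.elim i j) = μ then 1 else 0

open Classical in
/-- The basis tensor of the biases. -/
def basisC {l n : ℕ} (lam : Setoid (Fin l)) (j : MIdx l n) : ℝ :=
  if Setoid.ker j = lam then 1 else 0

open Classical in
/-- The classes used by lightweight layers: every entry of the input index `i` is equal to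
some entry of the output index `j`, so that no summation over the input takes place. -/
def lightweight (k l : ℕ) : Finset (PairPattern k l) :=
  Finset.univ.filter fun μ => ∀ a : Fin k, ∃ b : Fin l, μ (Sum.inl a) (Sum.inr b)

/-- Weights and biases of an equivariant linear layer from order `k` to order `l`. -/
structure LinParams (k l : ℕ) (C D : Type) where
  w : PairPattern k l → Matrix C D ℝ
  b : Setoid (Fin l) → D → ℝ

/-- The sparse lightweight equivariant linear layer with input hyperedges `E` and output
hyperedges `E'`. -/
def LinParams.apply {k l n : ℕ} {C D : Type} [Fintype C] (P : LinParams k l C D)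
    (E : Finset (MIdx k n)) (E' : Finset (MIdx l n)) (A : Tensor k n C) : Tensor l n D := fun j =>
  if j ∈ E' then
    (∑ μ ∈ lightweight k l, ∑ i ∈ E, basisB μ i j • (A i ᵥ* P.w μ)) + ∑ lam, basisC lam j • P.b lam
  else 0

/-! Sparse higher-order Transformer layers with kernel attention -/

/-- Parameters of a layer from order `k` to order `l`: feature channels `C`, `H` heads of size
`dH`, hidden dimension `dF` of the feedforward part. -/
structure EncParams (k l : ℕ) (C : Type) (H dH dF : ℕ) where
  /-- value weights -/
  wV : Fin H → PairPattern k l → Matrix C (Fin dH) ℝ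
  /-- output weights -/
  wO : Fin H → PairPattern k l → Matrix (Fin dH) C ℝ
  /-- query layers -/
  Q : Fin H → PairPattern k l → LinParams k l C (Fin dH)
  /-- key layers -/
  K : Fin H → PairPattern k l → LinParams k k C (Fin dH)
  /-- first layer of the feedforward part -/
  L1 : LinParams l l C (Fin dF)
  /-- second layer of the feedforward part -/
  L2 : LinParams l l (Fin dF) C

namespace EncParams

variable {k l n : ℕ} {C : Type} [Fintype C] {H dH dK dF : ℕ}

/-- The kernel score `φ(Q_j)ᵀ φ(K_i)` of head `h` and class `μ`. -/
def score (P : EncParams k l C H dH dF) (φ : (Fin dH → ℝ) → Fin dK → ℝ)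
    (E : Finset (MIdx k n)) (E' : Finset (MIdx l n)) (A : Tensor k n C)
    (h : Fin H) (μ : PairPattern k l) (i : MIdx k n) (j : MIdx l n) : ℝ :=
  φ ((P.Q h μ).apply E E' A j) ⬝ᵥ φ ((P.K h μ).apply E E A i)

/-- The attention coefficient for `i ∈ E`, `j ∈ E'`. It is zero unless `(i, j)` has pattern `μ`.
If `normalized` is true, it is divided by the sum of the scores over the keys `i ∈ E` with
`(i, j)` of pattern `μ`. -/
def coef (P : EncParams k l C H dH dF) (φ : (Fin dH → ℝ) → Fin dK → ℝ) (normalized : Bool)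
    (E : Finset (MIdx k n)) (E' : Finset (MIdx l n)) (A : Tensor k n C)
    (h : Fin H) (μ : PairPattern k l) (i : MIdx k n) (j : MIdx l n) : ℝ :=
  basisB μ i j * P.score φ E E' A h μ i j /
    (if normalized then ∑ i' ∈ E, basisB μ i' j * P.score φ E E' A h μ i' j else 1)

/-- Sparse multi-head kernel self-attention. -/
def attn (P : EncParams k l C H dH dF) (φ : (Fin dH → ℝ) → Fin dK → ℝ) (normalized : Bool)
    (E : Finset (MIdx k n)) (E' : Finset (MIdx l n)) (A : Tensor k n C) : Tensor l n C := fun j =>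
  if j ∈ E' then
    ∑ h, ∑ μ, ∑ i ∈ E, P.coef φ normalized E E' A h μ i j • (A i ᵥ* P.wV h μ ᵥ* P.wO h μ)
  else 0

/-- The feedforward part: linear layer, ReLU, linear layer. -/
def mlp (P : EncParams k l C H dH dF) (E' : Finset (MIdx l n)) (B : Tensor l n C) : Tensor l n C :=
  P.L2.apply E' E' fun j f => max 0 (P.L1.apply E' E' B j f)

/-- The Transformer layer `Enc = Attn + MLP ∘ Attn` with sparse hyperedge sets `E`, `E'`. -/
def enc (P : EncParams k l C H dH dF) (φ : (Fin dH → ℝ) → Fin dK → ℝ) (normalized : Bool)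
    (E : Finset (MIdx k n)) (E' : Finset (MIdx l n)) (A : Tensor k n C) : Tensor l n C :=
  P.attn φ normalized E E' A + P.mlp E' (P.attn φ normalized E E' A)

end EncParams

/-! Graphs as second-order tensors -/

/-- The edge set together with all the loops; the loop at `i` represents the node `i`. -/
def withLoops {n : ℕ} (E : Finset (MIdx 2 n)) : Finset (MIdx 2 n) :=
  E ∪ Finset.univ.image fun i : Fin n => ![i, i]

/-- Channels: source features, target features, edge features, and `p` channels of padding. -/
abbrev Chan (dv de p : ℕ) : Type := (Fin dv ⊕ Fin dv) ⊕ (Fin de ⊕ Fin p)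

/-- Node features `X` and edge features `F` as one tensor, with entry `(X_i, X_j, F_ij, 0)`
at `(i, j)`. -/
def encode {n dv de : ℕ} (p : ℕ) (X : Fin n → Fin dv → ℝ) (F : Fin n → Fin n → Fin de → ℝ) :
    Tensor 2 n (Chan dv de p) := fun i =>
  Sum.elim (Sum.elim (X (i 0)) (X (i 1))) (Sum.elim (F (i 0) (i 1)) 0)

/-! Message passing -/

/-- Message function and update function of one message passing step. -/
structure MPStep (dv de dm d : ℕ) where
  M : (Fin dv → ℝ) × (Fin dv → ℝ) × (Fin de → ℝ) → Fin dm → ℝ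
  U : (Fin dv → ℝ) × (Fin dm → ℝ) → Fin d → ℝ

/-- One message passing step along the edges `(i, j) ∈ E`, from `i` to `j`. -/
def MPStep.apply {n dv de dm d : ℕ} (S : MPStep dv de dm d) (E : Finset (MIdx 2 n))
    (X : Fin n → Fin dv → ℝ) (F : Fin n → Fin n → Fin de → ℝ) : Fin n → Fin d → ℝ := fun j =>
  S.U (X j, ∑ i with ![i, j] ∈ E, S.M (X j, X i, F i j))

/-- Message passing networks: `MPNN dv de T d` consists of `T` successive steps, with node
features of dimension `dv` at the input and `d` at the output. -/
inductive MPNN (dv de : ℕ) : ℕ → ℕ → Type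
  | input : MPNN dv de 0 dv
  | step {T d dm d' : ℕ} (net : MPNN dv de T d) (S : MPStep d de dm d') : MPNN dv de (T + 1) d'

/-- The node features computed by a message passing network. -/
def MPNN.eval {n dv de : ℕ} (E : Finset (MIdx 2 n)) (X : Fin n → Fin dv → ℝ)
    (F : Fin n → Fin n → Fin de → ℝ) : {T d : ℕ} → MPNN dv de T d → Fin n → Fin d → ℝ
  | _, _, .input => X
  | _, _, .step net S => S.apply E (net.eval E X F) F

/-- Some message passing network with `T` steps on the graph `E`, followed by a nodewise readout,
approximates the map `g` with error less than `δ` for all features bounded by `r`. -/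
def MPApproximates {n dv de : ℕ} {C : Type} (E : Finset (MIdx 2 n)) (T : ℕ) (r δ : ℝ)
    (g : (Fin n → Fin dv → ℝ) → (Fin n → Fin n → Fin de → ℝ) → Fin n → C → ℝ) : Prop :=
  ∃ (d : ℕ) (net : MPNN dv de T d) (R : (Fin d → ℝ) → C → ℝ),
    ∀ (X : Fin n → Fin dv → ℝ) (F : Fin n → Fin n → Fin de → ℝ),
      (∀ i c, |X i c| ≤ r) → (∀ i j c, |F i j c| ≤ r) →
        ∀ j c, |R (net.eval E X F j) c - g X F j c| < δ

/-- There is a directed walk with `t` edges from `u` to `v`. -/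
def HasWalk {n : ℕ} (E : Finset (MIdx 2 n)) : ℕ → Fin n → Fin n → Prop
  | 0, u, v => u = v
  | t + 1, u, v => ∃ x, HasWalk E t u x ∧ ![x, v] ∈ E

/-- Directed distance, `⊤` if there is no walk. -/
def dist {n : ℕ} (E : Finset (MIdx 2 n)) (u v : Fin n) : ℕ∞ :=
  ⨅ (t : ℕ) (_ : HasWalk E t u v), (t : ℕ∞)

/-- The diameter of a graph, the largest distance. -/
def diameter {n : ℕ} (E : Finset (MIdx 2 n)) : ℕ∞ :=
  ⨆ (u : Fin n) (v : Fin n), dist E u v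

/-- Any two nodes are joined by a path that may use edges in both directions. -/
def IsConnected {n : ℕ} (E : Finset (MIdx 2 n)) : Prop :=
  ∀ u v : Fin n, Relation.EqvGen (fun a b => ![a, b] ∈ E) u v

end HOT

end

/-! Constant queries and keys `x` with `φ x ≠ 0` give every pair the same score `s = φ x ⬝ᵥ φ x >
0`. Unnormalized attention then sums `A i` times a matrix depending only on the equality pattern of
`(i, j)`, and `s⁻¹` is absorbed into the weights (`constScore_attn_false`).

For the positive half, the first attention is the identity, and the feedforward part writes an
approximate message into empty padding channels at every edge. The second attention keeps the node
features at `(v, v)` and adds up the messages at the edges into `v`; its feedforward part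
approximates the update. At most `N` messages arrive at a node, so uniform continuity of the update
on a compact ball controls the error (`exists_shallowNets`). Universality of ReLU networks comes
from Stone–Weierstrass for exponentials of linear forms, which are uniform limits of combinations of
ramps.

For the negative half, loops represent nodes and are always present, so the class of two distinct
loops lets a node sum over all other nodes, whatever the edges. After `T` message passing steps the
output at `v` ignores nodes without a walk of length at most `T` to `v` (`MPNN.eval_congr`).
Switching the feature of such a node between `r` and `-r` moves the layer's output but not the
network's. -/

noncomputable section

/-! ### Universal approximation by ReLU networks -/

/-- Piecewise linear interpolation of `g` at the nodes `a + k * h`, written as a combination of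
ramps `max 0 (x - t)`. -/
theorem abs_sub_ramp_interpolation_le (g : ℝ → ℝ) (a h η : ℝ) (hh : 0 < h) (hη : 0 ≤ η) (m : ℕ)
    (hg : ∀ k < m, ∀ x ∈ Set.Icc (a + k * h) (a + (k + 1) * h), |g x - g (a + k * h)| ≤ η) :
    ∀ x ∈ Set.Icc a (a + m * h),
      |g x - (g a + ∑ k ∈ Finset.range m, (g (a + (k + 1) * h) - g (a + k * h)) / h *
        (max 0 (x - (a + k * h)) - max 0 (x - (a + (k + 1) * h))))| ≤ 2 * η := by
  -- To the right of all nodes each ramp difference equals `h`, so the sum telescopes.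
  have hfar : ∀ m : ℕ, ∀ x, a + m * h ≤ x →
      g a + ∑ k ∈ Finset.range m, (g (a + (k + 1) * h) - g (a + k * h)) / h *
        (max 0 (x - (a + k * h)) - max 0 (x - (a + (k + 1) * h))) = g (a + m * h) := by
    intro m
    induction m with
    | zero => intro x _; simp
    | succ m ih =>
      intro x hx
      push_cast at hx ⊢
      rw [Finset.sum_range_succ, ← add_assoc, ih x (by nlinarith), max_eq_right (by nlinarith),
        max_eq_right (by nlinarith)]
      field_simp
      ring
  induction m with
  | zero =>
    intro x hx
    have : x = a := by simpa using hx
    subst this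
    simp [hη]
  | succ m ih =>
    intro x hx
    rw [Finset.sum_range_succ, ← add_assoc]
    push_cast at hx
    rcases le_total x (a + m * h) with hxm | hxm
    · rw [max_eq_left (by linarith), max_eq_left (by nlinarith), sub_zero, mul_zero, add_zero]
      exact ih (fun k hk => hg k (by omega)) x ⟨hx.1, hxm⟩
    · rw [hfar m x hxm, max_eq_right (by linarith), max_eq_left (by linarith [hx.2]), sub_zero]
      have h1 := hg m (by omega) x ⟨hxm, hx.2⟩
      have h2 := hg m (by omega) (a + (m + 1) * h) ⟨by nlinarith, le_rfl⟩
      have h3 : |(g (a + (m + 1) * h) - g (a + m * h)) / h * (x - (a + m * h))| ≤ η := by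
        rw [div_mul_eq_mul_div, mul_div_assoc, abs_mul]
        have : |(x - (a + m * h)) / h| ≤ 1 := by
          rw [abs_of_nonneg (div_nonneg (by linarith) hh.le), div_le_one hh]
          linarith [hx.2]
        calc _ ≤ η * 1 := mul_le_mul h2 this (abs_nonneg _) hη
          _ = η := mul_one η
      calc _ = |(g x - g (a + m * h)) -
            (g (a + (m + 1) * h) - g (a + m * h)) / h * (x - (a + m * h))| := by congr 1; ring
        _ ≤ _ := (abs_sub _ _).trans (by linarith)

section Approximation

variable {ι : Type*} [Fintype ι] (K : Set (ι → ℝ))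

/-- The ridge function `x ↦ max 0 (⟨x, w⟩ + b)` on `K`. -/
def reluRidge (p : (ι → ℝ) × ℝ) : C(K, ℝ) where
  toFun x := max 0 (x.1 ⬝ᵥ p.1 + p.2)
  continuous_toFun := continuous_const.max
    ((continuous_subtype_val.dotProduct continuous_const).add continuous_const)

/-- The ridge function `x ↦ exp ⟨x, w⟩` on `K`. -/
def expRidge (w : ι → ℝ) : C(K, ℝ) where
  toFun x := Real.exp (x.1 ⬝ᵥ w)
  continuous_toFun :=
    Real.continuous_exp.comp (continuous_subtype_val.dotProduct continuous_const)

/-- On a compact set `x ⬝ᵥ w` stays in an interval, where `exp` is uniformly approximated by its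
interpolant; ramps in `x ⬝ᵥ w` are ReLU ridge functions. -/
theorem expRidge_mem_closure_span_reluRidge [CompactSpace K] (w : ι → ℝ) :
    expRidge K w ∈ (Submodule.span ℝ (Set.range (reluRidge K))).topologicalClosure := by
  change expRidge K w ∈ closure (Submodule.span ℝ (Set.range (reluRidge K)) : Set C(K, ℝ))
  rw [Metric.mem_closure_iff]
  intro ε hε
  obtain ⟨R, hR⟩ : ∃ R, ∀ x : K, |x.1 ⬝ᵥ w| ≤ R := by
    have hc : Continuous fun x : K => |x.1 ⬝ᵥ w| :=
      (continuous_subtype_val.dotProduct continuous_const).abs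
    obtain ⟨R, hR⟩ := (isCompact_range hc).bddAbove
    exact ⟨R, fun x => hR ⟨x, rfl⟩⟩
  set S := |R| + 1
  have hS : 0 < S := by positivity
  have huc := (isCompact_Icc (a := -S) (b := S)).uniformContinuousOn_of_continuous
    Real.continuous_exp.continuousOn
  rw [Metric.uniformContinuousOn_iff] at huc
  obtain ⟨δ, hδ, huc⟩ := huc (ε / 4) (by positivity)
  obtain ⟨m, hm⟩ := exists_nat_gt (2 * S / δ)
  have hm0 : (0 : ℝ) < m := lt_trans (by positivity) hm
  set h := 2 * S / m with hh
  have hh0 : 0 < h := by positivity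
  have hhδ : h < δ := by rwa [hh, div_lt_comm₀ hm0 hδ]
  have hmh : m * h = 2 * S := by rw [hh]; field_simp
  have key := abs_sub_ramp_interpolation_le Real.exp (-S) h (ε / 4) hh0 (by positivity) m (by
    intro k hk x hx
    have hk' : ((k : ℝ) + 1) ≤ m := by exact_mod_cast hk
    have hk0 : (0 : ℝ) ≤ k := by positivity
    have hkm : ((k : ℝ) + 1) * h ≤ 2 * S := hmh ▸ mul_le_mul_of_nonneg_right hk' hh0.le
    have hkh : 0 ≤ (k : ℝ) * h := by positivity
    refine (huc x ⟨by linarith [hx.1], by linarith [hx.2]⟩ (-S + k * h)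
      ⟨by linarith, by linarith⟩ ?_).le
    rw [Real.dist_eq, abs_of_nonneg (by linarith [hx.1])]
    linarith [hx.2])
  let c : ℕ → ℝ := fun k => (Real.exp (-S + (k + 1) * h) - Real.exp (-S + k * h)) / h
  -- The ridge function with data `(0, 1)` is the constant `1`; the offset `S - k * h` places the
  -- ramp at the node `-S + k * h`.
  refine ⟨Real.exp (-S) • reluRidge K (0, 1) + ∑ k ∈ Finset.range m,
    c k • (reluRidge K (w, S - k * h) - reluRidge K (w, S - (k + 1) * h)), ?_, ?_⟩
  · have hmem : ∀ p, reluRidge K p ∈ Submodule.span ℝ (Set.range (reluRidge K)) :=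
      fun p => Submodule.subset_span ⟨p, rfl⟩
    exact add_mem (Submodule.smul_mem _ _ (hmem _)) (Submodule.sum_mem _ fun k _ =>
      Submodule.smul_mem _ _ (sub_mem (hmem _) (hmem _)))
  · rw [ContinuousMap.dist_lt_iff hε]
    intro x
    have hx := abs_le.1 ((hR x).trans (le_abs_self R))
    have := key (x.1 ⬝ᵥ w) ⟨by linarith [hx.1], by rw [hmh]; linarith [hx.2]⟩
    rw [Real.dist_eq]
    refine lt_of_le_of_lt (le_of_eq ?_) (this.trans_lt (by linarith : 2 * (ε / 4) < ε))
    simp only [expRidge, reluRidge, ContinuousMap.coe_mk, ContinuousMap.add_apply,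
      ContinuousMap.coe_smul, Pi.smul_apply, ContinuousMap.coe_sum, Finset.sum_apply,
      ContinuousMap.sub_apply, dotProduct_zero, smul_eq_mul, c]
    congr 3
    · norm_num
    · refine Finset.sum_congr rfl fun k _ => ?_
      congr 3 <;> ring

/-- Products of exponential ridges are exponential ridges, so the algebra they generate is their
linear span. It separates points, hence is dense by Stone–Weierstrass. -/
theorem closure_span_reluRidge [CompactSpace K] :
    (Submodule.span ℝ (Set.range (reluRidge K))).topologicalClosure = ⊤ := by
  let e : Multiplicative (ι → ℝ) →* C(K, ℝ) :=
    { toFun := fun w => expRidge K w.toAdd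
      map_one' := by ext x; simp [expRidge]
      map_mul' := by intro v w; ext x; simp [expRidge, dotProduct_add, Real.exp_add] }
  have hsep : (Algebra.adjoin ℝ (MonoidHom.mrange e : Set C(K, ℝ))).SeparatesPoints := by
    classical
    intro x y hxy
    obtain ⟨i, hi⟩ : ∃ i, x.1 i ≠ y.1 i := by
      by_contra! hcon
      exact hxy (Subtype.ext (funext hcon))
    refine ⟨_, ⟨e (Multiplicative.ofAdd (Pi.single i 1)),
      Algebra.subset_adjoin ⟨_, rfl⟩, rfl⟩, ?_⟩
    simpa [e, expRidge] using hi
  have htop := ContinuousMap.subalgebra_topologicalClosure_eq_top_of_separatesPoints _ hsep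
  rw [eq_top_iff]
  intro f _
  have hf : f ∈ (Algebra.adjoin ℝ (MonoidHom.mrange e : Set C(K, ℝ))).topologicalClosure := by
    rw [htop]; trivial
  refine closure_minimal (?_ : (_ : Set C(K, ℝ)) ⊆ _)
    (Submodule.isClosed_topologicalClosure _) hf
  intro g hg
  have hg' : g ∈ Subalgebra.toSubmodule (Algebra.adjoin ℝ (MonoidHom.mrange e : Set C(K, ℝ))) := hg
  rw [Algebra.adjoin_eq_span_of_subset _
    (by rw [Submonoid.closure_eq]; exact Submodule.subset_span)] at hg'
  refine (Submodule.span_le.2 ?_) hg'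
  rintro _ ⟨w, rfl⟩
  exact expRidge_mem_closure_span_reluRidge K _

variable {K}

theorem exists_relu_network_scalar (hK : IsCompact K) (f : (ι → ℝ) → ℝ) (hf : Continuous f)
    {ε : ℝ} (hε : 0 < ε) :
    ∃ (m : ℕ) (w : Fin m → ι → ℝ) (b a : Fin m → ℝ),
      ∀ x ∈ K, |∑ k, a k * max 0 (x ⬝ᵥ w k + b k) - f x| < ε := by
  have : CompactSpace K := isCompact_iff_compactSpace.1 hK
  let f' : C(K, ℝ) := ⟨fun x => f x.1, by fun_prop⟩
  have hmem : f' ∈ closure (Submodule.span ℝ (Set.range (reluRidge K)) : Set C(K, ℝ)) := by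
    have : f' ∈ (Submodule.span ℝ (Set.range (reluRidge K))).topologicalClosure := by
      rw [closure_span_reluRidge]; trivial
    exact this
  obtain ⟨g, hg, hd⟩ := Metric.mem_closure_iff.1 hmem ε hε
  obtain ⟨m, a, v, rfl⟩ := Submodule.mem_span_set'.1 hg
  choose q hq using fun k => (v k).2
  refine ⟨m, fun k => (q k).1, fun k => (q k).2, a, fun x hx => ?_⟩
  have := (ContinuousMap.dist_lt_iff hε).1 hd ⟨x, hx⟩
  rw [dist_comm, Real.dist_eq] at this
  simpa [← hq, reluRidge, f'] using this

/-- Universal approximation by ReLU networks with one hidden layer. -/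
theorem exists_relu_network {κ : Type*} [Fintype κ] (hK : IsCompact K)
    (f : (ι → ℝ) → κ → ℝ) (hf : Continuous f) {ε : ℝ} (hε : 0 < ε) :
    ∃ (m : ℕ) (W : Matrix ι (Fin m) ℝ) (b : Fin m → ℝ) (V : Matrix (Fin m) κ ℝ),
      ∀ x ∈ K, ∀ c, |((fun k => max 0 ((x ᵥ* W + b) k)) ᵥ* V) c - f x c| < ε := by
  classical
  choose m w b a h using fun c : κ => exists_relu_network_scalar hK (fun x => f x c)
    ((continuous_apply c).comp hf) hε
  let e : Fin _ ≃ (Σ c, Fin (m c)) := (Fintype.equivFin _).symm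
  -- The hidden units of the scalar networks are placed side by side; output `c` reads only its own
  -- block.
  refine ⟨_, Matrix.of fun i k => w (e k).1 (e k).2 i, fun k => b (e k).1 (e k).2,
    Matrix.of fun k c => if (e k).1 = c then a (e k).1 (e k).2 else 0, fun x hx c => ?_⟩
  refine lt_of_le_of_lt (le_of_eq ?_) (h c x hx)
  congr 2
  simp only [vecMul, dotProduct, Matrix.of_apply, Pi.add_apply]
  rw [Equiv.sum_comp e fun k => max 0 (∑ i, x i * w k.1 k.2 i + b k.1 k.2) *
    if k.1 = c then a k.1 k.2 else 0, Fintype.sum_sigma, Finset.sum_eq_single c]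
  · simp [mul_comm]
  · intro c' _ hc; simp [hc]
  · simp

end Approximation

/-! ### Pointwise linear layers and attention with constant scores -/

namespace HOT

/-- Every pair of indices lies in exactly one class. -/
theorem sum_basisB_smul {k l n : ℕ} {V : Type*} [AddCommMonoid V] [Module ℝ V]
    (f : PairPattern k l → V) (i : MIdx k n) (j : MIdx l n) :
    ∑ μ, basisB μ i j • f μ = f (Setoid.ker (Sum.elim i j)) := by
  classical
  rw [Finset.sum_eq_single (Setoid.ker (Sum.elim i j))]
  · simp [basisB]
  · intro μ _ hμ; simp [basisB, hμ.symm]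
  · simp

theorem sum_basisC_smul {l n : ℕ} {V : Type*} [AddCommMonoid V] [Module ℝ V] (v : V)
    (j : MIdx l n) : ∑ lam, basisC lam j • v = v := by
  classical
  rw [Finset.sum_eq_single (Setoid.ker j)]
  · simp [basisC]
  · intro μ _ hμ; simp [basisC, hμ.symm]
  · simp

/-- The layer whose value is the constant `c` on all output hyperedges. -/
def LinParams.const {k l : ℕ} {C D : Type} (c : D → ℝ) : LinParams k l C D where
  w _ := 0
  b _ := c

theorem LinParams.const_apply {k l n : ℕ} {C D : Type} [Fintype C] (c : D → ℝ)
    (E : Finset (MIdx k n)) (E' : Finset (MIdx l n)) (A : Tensor k n C) {j : MIdx l n}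
    (hj : j ∈ E') : (LinParams.const c : LinParams k l C D).apply E E' A j = c := by
  simp only [LinParams.apply, LinParams.const, if_pos hj, vecMul_zero, smul_zero,
    Finset.sum_const_zero, zero_add]
  exact sum_basisC_smul c j

open Classical in
/-- The layer that applies an affine map at each hyperedge separately. -/
def LinParams.pointwise {k : ℕ} {C D : Type} (W : Matrix C D ℝ) (c : D → ℝ) :
    LinParams k k C D where
  w μ := if ∀ a, μ (Sum.inl a) (Sum.inr a) then W else 0
  b _ := c

theorem LinParams.pointwise_apply {k n : ℕ} {C D : Type} [Fintype C] (W : Matrix C D ℝ)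
    (c : D → ℝ) (E : Finset (MIdx k n)) (A : Tensor k n C) {j : MIdx k n} (hj : j ∈ E) :
    (LinParams.pointwise W c).apply E E A j = A j ᵥ* W + c := by
  classical
  have hcond : ∀ i, (∀ a, (Setoid.ker (Sum.elim i j)) (Sum.inl a) (Sum.inr a)) ↔ i = j := by
    intro i
    simp [funext_iff]
  -- Classes with nonzero weight force `i = j`, hence are lightweight, so the sum may run over all
  -- classes.
  have hsub : ∑ μ ∈ lightweight k k, ∑ i ∈ E,
      basisB μ i j • (A i ᵥ* (LinParams.pointwise W c : LinParams k k C D).w μ) =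
      ∑ μ, ∑ i ∈ E, basisB μ i j • (A i ᵥ* (LinParams.pointwise W c : LinParams k k C D).w μ) := by
    refine Finset.sum_subset (Finset.subset_univ _) fun μ _ hμ => ?_
    have : ¬ ∀ a, μ (Sum.inl a) (Sum.inr a) := fun h =>
      hμ (by simpa [lightweight] using fun a => ⟨a, h a⟩)
    simp [LinParams.pointwise, this]
  simp only [LinParams.apply, if_pos hj]
  rw [hsub, Finset.sum_comm]
  congr 1
  · rw [Finset.sum_congr rfl fun i _ => sum_basisB_smul _ i j, Finset.sum_eq_single_of_mem j hj]
    · simp only [LinParams.pointwise, hcond, if_true]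
    · intro i _ hi
      simp only [LinParams.pointwise, hcond, if_neg hi, vecMul_zero]
  · exact sum_basisC_smul c j

namespace EncParams

theorem mlp_pointwise {H k l n dH dF : ℕ} {C : Type} [Fintype C] (E' : Finset (MIdx l n))
    (P : EncParams k l C H dH dF) (W₁ : Matrix C (Fin dF) ℝ)
    (b : Fin dF → ℝ) (W₂ : Matrix (Fin dF) C ℝ) (h1 : P.L1 = LinParams.pointwise W₁ b)
    (h2 : P.L2 = LinParams.pointwise W₂ 0) (B : Tensor l n C) {j : MIdx l n} (hj : j ∈ E') :
    P.mlp E' B j = (fun f => max 0 ((B j ᵥ* W₁ + b) f)) ᵥ* W₂ := by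
  rw [mlp, h2, LinParams.pointwise_apply _ _ _ _ hj, add_zero]
  simp only [h1, LinParams.pointwise_apply _ _ _ _ hj]

variable {n dH dK : ℕ} {C : Type} [Fintype C] [DecidableEq C]

/-- A layer with constant queries and keys `x`, one head for each channel, and value weights `W`. -/
def constScore {k l dF : ℕ} (x : Fin dH → ℝ) (a : Fin dH) (W : PairPattern k l → Matrix C C ℝ)
    (L1 : LinParams l l C (Fin dF)) (L2 : LinParams l l (Fin dF) C) :
    EncParams k l C (Fintype.card C) dH dF where
  wV h _ := vecMulVec (Pi.single ((Fintype.equivFin C).symm h) 1) (Pi.single a 1)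
  wO h μ := vecMulVec (Pi.single a 1) (W μ ((Fintype.equivFin C).symm h))
  Q _ _ := LinParams.const x
  K _ _ := LinParams.const x
  L1 := L1
  L2 := L2

variable {k l dF : ℕ} (x : Fin dH → ℝ) (a : Fin dH) (W : PairPattern k l → Matrix C C ℝ)
    (L1 : LinParams l l C (Fin dF)) (L2 : LinParams l l (Fin dF) C)
    (φ : (Fin dH → ℝ) → Fin dK → ℝ) (E : Finset (MIdx k n)) (E' : Finset (MIdx l n))
    (A : Tensor k n C)

/-- The head of channel `c` contributes the rank-one matrix whose only nonzero row is row `c` of `W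
μ`. Summing over channels recovers `W μ`, even when `dH = 1`. -/
theorem constScore_attn (nz : Bool) {j : MIdx l n} (hj : j ∈ E') :
    (constScore x a W L1 L2).attn φ nz E E' A j =
      ∑ μ, ∑ i ∈ E, (basisB μ i j * (φ x ⬝ᵥ φ x) /
        (if nz then ∑ i' ∈ E, basisB μ i' j * (φ x ⬝ᵥ φ x) else 1)) • (A i ᵥ* W μ) := by
  have hscore : ∀ h μ, ∀ i ∈ E,
      (constScore x a W L1 L2).score φ E E' A h μ i j = φ x ⬝ᵥ φ x := by
    intro h μ i hi
    simp only [score, constScore, LinParams.const_apply x E E' A hj,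
      LinParams.const_apply x E E A hi]
  have hcoef : ∀ h μ, ∀ i ∈ E, (constScore x a W L1 L2).coef φ nz E E' A h μ i j =
      basisB μ i j * (φ x ⬝ᵥ φ x) /
        (if nz then ∑ i' ∈ E, basisB μ i' j * (φ x ⬝ᵥ φ x) else 1) := by
    intro h μ i hi
    rw [coef, hscore h μ i hi, Finset.sum_congr rfl fun i' hi' => by rw [hscore h μ i' hi']]
  have hval : ∀ i μ, ∑ h, (A i ᵥ* (constScore x a W L1 L2).wV h μ ᵥ*
      (constScore x a W L1 L2).wO h μ) = A i ᵥ* W μ := by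
    intro i μ
    have hone : ∀ h, A i ᵥ* (constScore x a W L1 L2).wV h μ ᵥ*
        (constScore x a W L1 L2).wO h μ =
          A i ((Fintype.equivFin C).symm h) • W μ ((Fintype.equivFin C).symm h) := by
      intro h
      simp [constScore, vecMul_vecMulVec]
    rw [Finset.sum_congr rfl fun h _ => hone h,
      Equiv.sum_comp (Fintype.equivFin C).symm fun c => A i c • W μ c]
    ext c
    simp [vecMul, dotProduct]
  rw [attn, if_pos hj, Finset.sum_comm]
  refine Finset.sum_congr rfl fun μ _ => ?_
  rw [Finset.sum_comm]
  refine Finset.sum_congr rfl fun i hi => ?_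
  rw [← hval i μ, Finset.smul_sum]
  exact Finset.sum_congr rfl fun h _ => by rw [hcoef h μ i hi]

theorem constScore_attn_false (hs : φ x ⬝ᵥ φ x ≠ 0) {j : MIdx l n} (hj : j ∈ E') :
    (constScore x a (fun μ => (φ x ⬝ᵥ φ x)⁻¹ • W μ) L1 L2).attn φ false E E' A j =
      ∑ i ∈ E, A i ᵥ* W (Setoid.ker (Sum.elim i j)) := by
  rw [constScore_attn x a _ L1 L2 φ E E' A false hj, Finset.sum_comm]
  refine Finset.sum_congr rfl fun i _ => ?_
  rw [← sum_basisB_smul (fun μ => A i ᵥ* W μ) i j]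
  refine Finset.sum_congr rfl fun μ _ => ?_
  rw [vecMul_smul, smul_smul]
  congr 1
  simp [hs]

end EncParams
-- Approximation of one message passing step by two shallow networks
/-- A ReLU network with one hidden layer. -/
def shallowNet {ι κ : Type} [Fintype ι] {m : ℕ} (W : Matrix ι (Fin m) ℝ) (b : Fin m → ℝ)
    (V : Matrix (Fin m) κ ℝ) (y : ι → ℝ) : κ → ℝ :=
  (fun k => max 0 ((y ᵥ* W + b) k)) ᵥ* V

/-- The channels at a node with features `x` and aggregated messages `a`. -/
def nodeChannels {dv de dm d : ℕ} (x : Fin dv → ℝ) (a : Fin dm → ℝ) : Chan dv de (dm + d) → ℝ :=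
  Sum.elim (Sum.elim x x) (Sum.elim 0 (Fin.append a 0))

theorem abs_nodeChannels_le {dv de dm d : ℕ} {x : Fin dv → ℝ} {a : Fin dm → ℝ} {R : ℝ}
    (hR : 0 ≤ R) (hx : ∀ c, |x c| ≤ R) (ha : ∀ c, |a c| ≤ R) (c : Chan dv de (dm + d)) :
    |nodeChannels x a c| ≤ R := by
  rcases c with (c | c) | (c | c)
  · exact hx c
  · exact hx c
  · simpa [nodeChannels] using hR
  · induction c using Fin.addCases with
    | left c => simpa [nodeChannels] using ha c
    | right c => simpa [nodeChannels] using hR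

theorem dist_nodeChannels_lt {dv de dm d : ℕ} {x : Fin dv → ℝ} {a a' : Fin dm → ℝ} {δ : ℝ}
    (hδ : 0 < δ) (h : ∀ c, |a c - a' c| < δ) :
    Dist.dist (nodeChannels x a : Chan dv de (dm + d) → ℝ) (nodeChannels x a') < δ := by
  rw [dist_pi_lt_iff hδ]
  rintro ((c | c) | (c | c))
  · simpa [nodeChannels] using hδ
  · simpa [nodeChannels] using hδ
  · simpa [nodeChannels] using hδ
  · induction c using Fin.addCases with
    | left c => simpa [nodeChannels, Real.dist_eq] using h c
    | right c => simpa [nodeChannels] using hδ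

theorem mem_closedBall_zero_of_abs_le {ι : Type*} [Fintype ι] {R : ℝ} (hR : 0 ≤ R) {y : ι → ℝ}
    (h : ∀ c, |y c| ≤ R) : y ∈ Metric.closedBall (0 : ι → ℝ) R := by
  rw [mem_closedBall_zero_iff, pi_norm_le_iff_of_nonneg hR]
  exact h

theorem abs_sum_le_of_card_le {α : Type*} {s : Finset α} {f : α → ℝ} {N : ℕ} {η : ℝ} (hη : 0 ≤ η)
    (hs : s.card ≤ N) (h : ∀ u ∈ s, |f u| ≤ η) : |∑ u ∈ s, f u| ≤ N * η :=
  calc |∑ u ∈ s, f u| ≤ s.card * η := by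
        simpa using (Finset.abs_sum_le_sum_abs f s).trans (Finset.sum_le_card_nsmul s _ η h)
    _ ≤ N * η := by gcongr

/-- Two shallow networks, for messages and for updates, approximate a message passing step with
at most `N` messages to each node. -/
theorem exists_shallowNets {dv de dm d : ℕ} (S : MPStep dv de dm d) (hM : Continuous S.M)
    (hU : Continuous S.U) (N : ℕ) (r ε : ℝ) (hε : 0 < ε) :
    ∃ (m₁ m₂ : ℕ) (W₁ : Matrix (Chan dv de (dm + d)) (Fin m₁) ℝ) (b₁ : Fin m₁ → ℝ)
      (V₁ : Matrix (Fin m₁) (Fin dm) ℝ) (W₂ : Matrix (Chan dv de (dm + d)) (Fin m₂) ℝ)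
      (b₂ : Fin m₂ → ℝ) (V₂ : Matrix (Fin m₂) (Fin d) ℝ),
      ∀ {α : Type} (s : Finset α) (x : Fin dv → ℝ) (X : α → Fin dv → ℝ) (F : α → Fin de → ℝ),
        s.card ≤ N → (∀ c, |x c| ≤ r) → (∀ u c, |X u c| ≤ r) → (∀ u c, |F u c| ≤ r) →
        ∀ c, |shallowNet W₂ b₂ V₂ (nodeChannels x (∑ u ∈ s, shallowNet W₁ b₁ V₁
          (Sum.elim (Sum.elim (X u) x) (Sum.elim (F u) 0)))) c -
            S.U (x, ∑ u ∈ s, S.M (x, X u, F u)) c| < ε := by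
  let f : (Chan dv de (dm + d) → ℝ) → Fin dm → ℝ := fun y =>
    S.M (fun c => y (.inl (.inr c)), fun c => y (.inl (.inl c)), fun c => y (.inr (.inl c)))
  let g : (Chan dv de (dm + d) → ℝ) → Fin d → ℝ := fun y =>
    S.U (fun c => y (.inl (.inr c)), fun c => y (.inr (.inr (Fin.castAdd d c))))
  have hf : Continuous f := by fun_prop
  have hg : Continuous g := by fun_prop
  have hK := isCompact_closedBall (0 : Chan dv de (dm + d) → ℝ) |r|
  obtain ⟨B, hB⟩ := (hK.image hf).isBounded.exists_norm_le
  -- This radius contains the node features and any sum of at most `N` messages, exact or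
  -- approximate; the `1` allows for the approximation error.
  set R := max |r| (N * (|B| + 1))
  have hR : 0 ≤ R := (abs_nonneg r).trans (le_max_left _ _)
  have hK' := isCompact_closedBall (0 : Chan dv de (dm + d) → ℝ) R
  have huc := hK'.uniformContinuousOn_of_continuous hg.continuousOn
  obtain ⟨δ, hδ, huc⟩ := Metric.uniformContinuousOn_iff.1 huc (ε / 2) (half_pos hε)
  -- The bound by `1` keeps approximate messages within `|B| + 1`; the other bound keeps the total
  -- error of `N` messages below `δ`.
  set η := min 1 (δ / (N + 1))
  have hη : 0 < η := by positivity
  have hNη : N * η < δ := by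
    calc N * η ≤ N * (δ / (N + 1)) := by gcongr; exact min_le_right _ _
      _ < (N + 1) * (δ / (N + 1)) := by gcongr; linarith
      _ = δ := by field_simp
  obtain ⟨m₁, W₁, b₁, V₁, h₁⟩ := exists_relu_network hK f hf hη
  obtain ⟨m₂, W₂, b₂, V₂, h₂⟩ := exists_relu_network hK' g hg (half_pos hε)
  refine ⟨m₁, m₂, W₁, b₁, V₁, W₂, b₂, V₂, fun {α} s x X F hs hx hX hF c => ?_⟩
  have hr := le_abs_self r
  set y : α → Chan dv de (dm + d) → ℝ := fun u => Sum.elim (Sum.elim (X u) x) (Sum.elim (F u) 0)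
  have hy : ∀ u, y u ∈ Metric.closedBall (0 : Chan dv de (dm + d) → ℝ) |r| := by
    refine fun u => mem_closedBall_zero_of_abs_le (abs_nonneg r) ?_
    rintro ((c | c) | (c | c))
    · exact (hX u c).trans hr
    · exact (hx c).trans hr
    · exact (hF u c).trans hr
    · simp [y]
  have hfy : ∀ u, S.M (x, X u, F u) = f (y u) := fun u => rfl
  have hfB : ∀ u c, |f (y u) c| ≤ |B| := fun u c =>
    ((norm_le_pi_norm (f (y u)) c).trans (hB _ ⟨_, hy u, rfl⟩)).trans (le_abs_self B)
  have herr : ∀ u c, |shallowNet W₁ b₁ V₁ (y u) c - f (y u) c| < η := fun u => h₁ _ (hy u)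
  have hnetB : ∀ u c, |shallowNet W₁ b₁ V₁ (y u) c| ≤ |B| + 1 := by
    intro u c
    have := abs_add_le (shallowNet W₁ b₁ V₁ (y u) c - f (y u) c) (f (y u) c)
    rw [sub_add_cancel] at this
    linarith [herr u c, hfB u c, min_le_left 1 (δ / (N + 1) : ℝ)]
  have hball : ∀ a : α → Fin dm → ℝ, (∀ u c, |a u c| ≤ |B| + 1) →
      (nodeChannels x (∑ u ∈ s, a u)) ∈ Metric.closedBall (0 : Chan dv de (dm + d) → ℝ) R := by
    intro a ha
    refine mem_closedBall_zero_of_abs_le hR (abs_nodeChannels_le hR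
      (fun c => (hx c).trans (hr.trans (le_max_left _ _))) fun c => ?_)
    rw [Finset.sum_apply]
    exact (abs_sum_le_of_card_le (by positivity) hs fun u _ => ha u c).trans (le_max_right _ _)
  have hz := hball _ hnetB
  have hz' := hball (fun u => f (y u)) fun u c => (hfB u c).trans (by linarith)
  have hgz : S.U (x, ∑ u ∈ s, S.M (x, X u, F u)) = g (nodeChannels x (∑ u ∈ s, f (y u))) := by
    have h : ∀ a : Fin dm → ℝ, g (nodeChannels x a) = S.U (x, a) := fun a => by
      simp [g, nodeChannels]
    simp only [h, hfy]
  -- Inexact messages cost `ε / 2` through the modulus of continuity of `g`; the update network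
  -- costs the other `ε / 2`.
  have hdist := huc _ hz _ hz' (dist_nodeChannels_lt hδ fun c => by
    rw [Finset.sum_apply, Finset.sum_apply, ← Finset.sum_sub_distrib]
    exact (abs_sum_le_of_card_le hη.le hs fun u _ => (herr u c).le).trans_lt hNη)
  have h3 := (dist_pi_lt_iff (half_pos hε)).1 hdist c
  have h4 := h₂ _ hz c
  rw [hgz]
  rw [Real.dist_eq] at h3
  refine (abs_sub_le _ (g (nodeChannels x (∑ u ∈ s, shallowNet W₁ b₁ V₁ (y u))) c) _).trans_lt ?_
  rw [shallowNet]
  linarith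

/-! ### Two Transformer layers simulating a message passing step -/

variable {n dH dK : ℕ}

/-- A layer whose attention scales channel `c` by `D μ c` for pairs of pattern `μ`, followed by a
network at each hyperedge. -/
theorem constScore_enc {C : Type} [Fintype C] [DecidableEq C] {k m : ℕ} (x : Fin dH → ℝ)
    (a : Fin dH) (φ : (Fin dH → ℝ) → Fin dK → ℝ) (hs : φ x ⬝ᵥ φ x ≠ 0)
    (D : PairPattern k k → C → ℝ) (W : Matrix C (Fin m) ℝ) (b : Fin m → ℝ)
    (V : Matrix (Fin m) C ℝ) (E : Finset (MIdx k n)) (A : Tensor k n C) {j : MIdx k n}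
    (hj : j ∈ E) :
    (EncParams.constScore x a (fun μ => (φ x ⬝ᵥ φ x)⁻¹ • diagonal (D μ))
      (LinParams.pointwise W b) (LinParams.pointwise V 0)).enc φ false E E A j =
      (fun c => ∑ i ∈ E, A i c * D (Setoid.ker (Sum.elim i j)) c) +
        shallowNet W b V (fun c => ∑ i ∈ E, A i c * D (Setoid.ker (Sum.elim i j)) c) := by
  have h := EncParams.constScore_attn_false x a (fun μ => diagonal (D μ)) (LinParams.pointwise W b)
    (LinParams.pointwise V 0) φ E E A hs hj
  have h' : ∑ i ∈ E, A i ᵥ* diagonal (D (Setoid.ker (Sum.elim i j))) =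
      fun c => ∑ i ∈ E, A i c * D (Setoid.ker (Sum.elim i j)) c := by
    ext c
    simp [Finset.sum_apply, vecMul_diagonal]
  rw [EncParams.enc, Pi.add_apply, EncParams.mlp_pointwise E _ W b V rfl rfl _ hj, h, h']
  rfl

theorem exists_layers_approximating_step (hdH : 0 < dH) (φ : (Fin dH → ℝ) → Fin dK → ℝ)
    {x : Fin dH → ℝ} (hs : φ x ⬝ᵥ φ x ≠ 0) {dv de dm d : ℕ} (S : MPStep dv de dm d)
    (hM : Continuous S.M) (hU : Continuous S.U) (N : ℕ) (r ε : ℝ) (hε : 0 < ε) (loops : Prop) :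
    ∃ (p H₁ H₂ dF₁ dF₂ : ℕ) (P₁ : EncParams 2 2 (Chan dv de p) H₁ dH dF₁)
      (P₂ : EncParams 2 2 (Chan dv de p) H₂ dH dF₂) (out : Fin d ↪ Chan dv de p),
      ∀ n ≤ N, ∀ E : Finset (MIdx 2 n), (∀ i, ![i, i] ∈ E ↔ loops) →
      ∀ (X : Fin n → Fin dv → ℝ) (F : Fin n → Fin n → Fin de → ℝ),
        (∀ i c, |X i c| ≤ r) → (∀ i j c, |F i j c| ≤ r) →
        ∀ j c,
          |P₂.enc φ false (withLoops E) (withLoops E)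
              (P₁.enc φ false (withLoops E) (withLoops E) (encode p X F)) ![j, j] (out c)
            - S.apply E X F j c| < ε := by
  classical
  obtain ⟨m₁, m₂, W₁, b₁, V₁, W₂, b₂, V₂, hnet⟩ := exists_shallowNets S hM hU N r ε hε
  let a : Fin dH := ⟨0, hdH⟩
  let D₁ : PairPattern 2 2 → Chan dv de (dm + d) → ℝ := fun μ _ =>
    if ∀ t, μ (Sum.inl t) (Sum.inr t) then 1 else 0
  -- Node features pass only from `j` to itself, messages from every hyperedge with the same target.
  -- As `withLoops` contains `(v, v)` in any case, `loops` decides whether its message counts; this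
  -- is why loops must be present at all nodes or at none.
  let D₂ : PairPattern 2 2 → Chan dv de (dm + d) → ℝ := fun μ =>
    Sum.elim (fun _ => if ∀ t, μ (Sum.inl t) (Sum.inr t) then 1 else 0)
      (Sum.elim 0 (Fin.append (fun _ => if μ (Sum.inl 1) (Sum.inr 1) ∧
        (loops ∨ ¬ μ (Sum.inl 0) (Sum.inl 1)) then 1 else 0) 0))
  -- Messages go to the first `dm` padding channels, results to the last `d`. These are still zero
  -- when written to, so the residual term does not disturb them.
  let V₁' : Matrix (Fin m₁) (Chan dv de (dm + d)) ℝ := Matrix.of fun k =>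
    Sum.elim 0 (Sum.elim 0 (Fin.append (V₁ k) 0))
  let V₂' : Matrix (Fin m₂) (Chan dv de (dm + d)) ℝ := Matrix.of fun k =>
    Sum.elim 0 (Sum.elim 0 (Fin.append 0 (V₂ k)))
  let out : Fin d ↪ Chan dv de (dm + d) :=
    ⟨fun c => .inr (.inr (Fin.natAdd dm c)), fun c c' h => by simpa using h⟩
  refine ⟨dm + d, _, _, m₁, m₂,
    EncParams.constScore x a (fun μ => (φ x ⬝ᵥ φ x)⁻¹ • diagonal (D₁ μ))
      (LinParams.pointwise W₁ b₁) (LinParams.pointwise V₁' 0),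
    EncParams.constScore x a (fun μ => (φ x ⬝ᵥ φ x)⁻¹ • diagonal (D₂ μ))
      (LinParams.pointwise W₂ b₂) (LinParams.pointwise V₂' 0), out, ?_⟩
  intro n hn E hE X F hX hF v c
  have hid : ∀ i j : MIdx 2 n,
      (∀ t, (Setoid.ker (Sum.elim i j)) (Sum.inl t) (Sum.inr t)) ↔ i = j := by
    intro i j; simp [funext_iff]
  set A := encode (dm + d) X F
  set A' := (EncParams.constScore x a (fun μ => (φ x ⬝ᵥ φ x)⁻¹ • diagonal (D₁ μ))
      (LinParams.pointwise W₁ b₁) (LinParams.pointwise V₁' 0)).enc φ false (withLoops E)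
      (withLoops E) A with hA'
  have hfirst : ∀ j ∈ withLoops E, A' j = A j + shallowNet W₁ b₁ V₁' (A j) := by
    intro j hj
    have : (fun c => ∑ i ∈ withLoops E, A i c * D₁ (Setoid.ker (Sum.elim i j)) c) = A j := by
      ext c
      simp only [D₁, hid]
      simp [hj]
    rw [hA', constScore_enc x a φ hs D₁ W₁ b₁ V₁' _ A hj, this]
  have hvv : ∀ v : Fin n, ![v, v] ∈ withLoops E := fun v =>
    Finset.mem_union_right _ (Finset.mem_image_of_mem _ (Finset.mem_univ v))
  have hnode : ∀ j ∈ withLoops E, ∀ c, A' j (.inl c) = A j (.inl c) := by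
    intro j hj c
    rw [hfirst j hj]
    simp [shallowNet, vecMul, V₁', dotProduct]
  have hmsg : ∀ j ∈ withLoops E, ∀ c : Fin dm, A' j (.inr (.inr (Fin.castAdd d c))) =
      shallowNet W₁ b₁ V₁ (A j) c := by
    intro j hj c
    rw [hfirst j hj]
    simp [shallowNet, vecMul, V₁', dotProduct, A, encode]
  set z : Chan dv de (dm + d) → ℝ :=
    nodeChannels (X v) (∑ u with ![u, v] ∈ E, shallowNet W₁ b₁ V₁ (A ![u, v])) with hz
  have hagg : (fun c => ∑ i ∈ withLoops E, A' i c * D₂ (Setoid.ker (Sum.elim i ![v, v])) c) = z := by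
    ext c
    rcases c with c | (c | c)
    · have : z (.inl c) = A' ![v, v] (.inl c) := by
        rw [hnode _ (hvv v)]
        rcases c with c | c <;> simp [hz, nodeChannels, A, encode]
      rw [this]
      simp only [D₂, hid, Sum.elim_inl]
      simp [hvv v]
    · simp [D₂, hz, nodeChannels]
    · induction c using Fin.addCases with
      | right c => simp [D₂, hz, nodeChannels]
      | left c =>
        simp only [D₂, hz, nodeChannels, Sum.elim_inr, Fin.append_left, Finset.sum_apply, mul_ite,
          mul_one, mul_zero]
        rw [← Finset.sum_filter]
        symm
        refine Finset.sum_bij (fun u _ => ![u, v]) ?_ ?_ ?_ ?_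
        · intro u hu
          have hu : ![u, v] ∈ E := by simpa using hu
          refine Finset.mem_filter.2 ⟨Finset.mem_union_left _ hu, by simp, ?_⟩
          by_cases huv : u = v
          · subst huv; exact Or.inl ((hE u).1 hu)
          · right; simpa using huv
        · intro u _ u' _ h; simpa using congrFun h 0
        · intro i hi
          obtain ⟨hiE, h1, h2⟩ := Finset.mem_filter.1 hi
          have h1 : i 1 = v := by simpa using h1
          have hi' : i = ![i 0, v] := by
            ext t; fin_cases t <;> simp [h1]
          refine ⟨i 0, ?_, hi'.symm⟩
          rw [Finset.mem_filter, ← hi']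
          refine ⟨Finset.mem_univ _, ?_⟩
          -- An added loop passes the filter only if `loops` holds, and then it is already an edge.
          rcases Finset.mem_union.1 hiE with h | h
          · exact h
          · obtain ⟨w, -, rfl⟩ := Finset.mem_image.1 h
            rcases h2 with h2 | h2
            · exact (hE w).2 h2
            · simp at h2
        · intro u hu
          have hu : ![u, v] ∈ E := by simpa using hu
          exact (hmsg _ (Finset.mem_union_left _ hu) c).symm
  rw [constScore_enc x a φ hs D₂ W₂ b₂ V₂' _ A' (hvv v), hagg]
  have hout : (z + shallowNet W₂ b₂ V₂' z) (out c) = shallowNet W₂ b₂ V₂ z c := by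
    have hc : out c = .inr (.inr (Fin.natAdd dm c)) := rfl
    have : z (.inr (.inr (Fin.natAdd dm c))) = 0 := by simp [hz, nodeChannels]
    rw [Pi.add_apply, hc, this, zero_add]
    simp [shallowNet, V₂', vecMul, dotProduct]
  rw [hout]
  exact hnet (Finset.univ.filter fun u => ![u, v] ∈ E) (X v) X (fun u => F u v)
    ((Finset.card_le_univ _).trans (by simpa using hn)) (hX v) hX (fun u => hF u v) c

/-! ### Locality of message passing -/

/-- Message passing with `T` steps only depends on features at nodes with a walk of length at
most `T` to the given node. -/
theorem MPNN.eval_congr {n dv de : ℕ} (E : Finset (MIdx 2 n)) {X X' : Fin n → Fin dv → ℝ}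
    (F : Fin n → Fin n → Fin de → ℝ) {T d : ℕ} (net : MPNN dv de T d) (v : Fin n)
    (h : ∀ u, ∀ t ≤ T, HasWalk E t u v → X u = X' u) : net.eval E X F v = net.eval E X' F v := by
  induction net generalizing v with
  | input => exact h v 0 le_rfl rfl
  | step net S ih =>
    have hv := ih v fun u t ht hw => h u t (by omega) hw
    simp only [MPNN.eval, MPStep.apply, hv]
    congr 2
    refine Finset.sum_congr rfl fun i hi => ?_
    rw [ih i fun u t ht hw => h u (t + 1) (by omega) ⟨i, hw, by simpa using hi⟩]

theorem HasWalk.eqvGen {n : ℕ} {E : Finset (MIdx 2 n)} {t : ℕ} {u v : Fin n}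
    (h : HasWalk E t u v) : Relation.EqvGen (fun a b => ![a, b] ∈ E) u v := by
  induction t generalizing v with
  | zero => cases h; exact .refl _
  | succ t ih =>
    obtain ⟨w, hw, hE⟩ := h
    exact .trans _ _ _ (ih hw) (.rel _ _ hE)

theorem exists_no_walk_of_lt_diameter {n T : ℕ} {E : Finset (MIdx 2 n)}
    (h : (T : ℕ∞) < diameter E) : ∃ u v, ∀ t ≤ T, ¬ HasWalk E t u v := by
  obtain ⟨u, h⟩ := lt_iSup_iff.1 h
  obtain ⟨v, h⟩ := lt_iSup_iff.1 h
  refine ⟨u, v, fun t ht hw => absurd h (not_lt.2 ?_)⟩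
  exact (iInf₂_le t hw).trans (by exact_mod_cast ht)

/-! ### A layer that sums over all other nodes -/

/-- The pattern of two distinct loops. -/
abbrev distinctLoops : PairPattern 2 2 := Setoid.ker Sum.isLeft

theorem ker_elim_eq_distinctLoops {n : ℕ} (i : MIdx 2 n) (v : Fin n) :
    Setoid.ker (Sum.elim i ![v, v]) = distinctLoops ↔ ∃ u, u ≠ v ∧ i = ![u, u] := by
  constructor
  · intro h
    have h' : ∀ a b, Sum.elim i ![v, v] a = Sum.elim i ![v, v] b ↔
        Sum.isLeft a = Sum.isLeft b := fun a b => Setoid.ext_iff.1 h a b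
    have h1 := h' (.inl 0) (.inl 1)
    have h2 := h' (.inl 0) (.inr 0)
    simp only [Sum.elim_inl, Sum.elim_inr, Sum.isLeft_inl, Sum.isLeft_inr] at h1 h2
    refine ⟨i 0, by simpa using h2, ?_⟩
    ext t
    fin_cases t <;> simp [h1.2 trivial]
  · rintro ⟨u, huv, rfl⟩
    refine Setoid.ext fun a b => ?_
    change Sum.elim ![u, u] ![v, v] a = Sum.elim ![u, u] ![v, v] b ↔ Sum.isLeft a = Sum.isLeft b
    have hu : ∀ t, (![u, u] : Fin 2 → Fin n) t = u := by intro t; fin_cases t <;> rfl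
    have hv : ∀ t, (![v, v] : Fin 2 → Fin n) t = v := by intro t; fin_cases t <;> rfl
    rcases a with a | a <;> rcases b with b | b <;> simp [hu, hv, huv, huv.symm]

/-- The right side does not involve `E`: attention through this class is global on every graph. -/
theorem sum_basisB_distinctLoops {n : ℕ} {V : Type*} [AddCommMonoid V] [Module ℝ V]
    (E : Finset (MIdx 2 n)) (v : Fin n) (f : MIdx 2 n → V) :
    ∑ i ∈ withLoops E, basisB distinctLoops i ![v, v] • f i =
      ∑ u ∈ Finset.univ.erase v, f ![u, u] := by
  classical
  simp only [basisB, ker_elim_eq_distinctLoops, ite_smul, one_smul, zero_smul]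
  rw [← Finset.sum_filter]
  symm
  refine Finset.sum_bij (fun u _ => ![u, u]) ?_ ?_ ?_ ?_
  · intro u hu
    exact Finset.mem_filter.2 ⟨Finset.mem_union_right _ (Finset.mem_image_of_mem _
      (Finset.mem_univ u)), u, Finset.ne_of_mem_erase hu, rfl⟩
  · intro u _ u' _ h; simpa using congrFun h 0
  · intro i hi
    obtain ⟨-, u, hu, rfl⟩ := Finset.mem_filter.1 hi
    exact ⟨u, by simpa using hu, rfl⟩
  · intro u _; rfl

/-- Some layer adds up, or averages, one feature over all other nodes. -/
theorem exists_layer_sum_other_nodes {dH dK : ℕ} (hdH : 0 < dH) (φ : (Fin dH → ℝ) → Fin dK → ℝ)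
    (x : Fin dH → ℝ) (normalized : Bool) (dv de p : ℕ) (a : Fin dv) :
    ∃ (H dF : ℕ) (P : EncParams 2 2 (Chan dv de p) H dH dF),
      ∀ (n : ℕ) (E : Finset (MIdx 2 n)) (X : Fin n → Fin dv → ℝ) (F : Fin n → Fin n → Fin de → ℝ)
        (v : Fin n),
        P.enc φ normalized (withLoops E) (withLoops E) (encode p X F) ![v, v] (.inl (.inl a)) =
          (φ x ⬝ᵥ φ x / if normalized then (n - 1 : ℝ) * (φ x ⬝ᵥ φ x) else 1) *
            ∑ u ∈ Finset.univ.erase v, X u a := by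
  classical
  let W : PairPattern 2 2 → Matrix (Chan dv de p) (Chan dv de p) ℝ := fun μ =>
    if μ = distinctLoops then 1 else 0
  refine ⟨_, 0, EncParams.constScore x ⟨0, hdH⟩ W (LinParams.pointwise 0 0)
    (LinParams.pointwise 0 0), fun n E X F v => ?_⟩
  have hv : ![v, v] ∈ withLoops E :=
    Finset.mem_union_right _ (Finset.mem_image_of_mem _ (Finset.mem_univ v))
  -- All scores agree, so normalization divides by `n - 1` of them and produces an average.
  have hcount : ∑ i' ∈ withLoops E, basisB distinctLoops i' ![v, v] * (φ x ⬝ᵥ φ x) =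
      (n - 1 : ℝ) * (φ x ⬝ᵥ φ x) := by
    have := sum_basisB_distinctLoops E v fun _ => φ x ⬝ᵥ φ x
    simp only [smul_eq_mul] at this
    rw [this, Finset.sum_const, Finset.card_erase_of_mem (Finset.mem_univ v), nsmul_eq_mul,
      Finset.card_univ, Fintype.card_fin, Nat.cast_sub (Fin.pos v), Nat.cast_one]
  rw [EncParams.enc, Pi.add_apply, EncParams.mlp_pointwise _ _ 0 0 0 rfl rfl _ hv, vecMul_zero,
    add_zero, EncParams.constScore_attn _ _ _ _ _ _ _ _ _ _ hv,
    Finset.sum_eq_single distinctLoops]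
  · rw [hcount]
    have := sum_basisB_distinctLoops E v fun i =>
      (φ x ⬝ᵥ φ x / if normalized then (n - 1 : ℝ) * (φ x ⬝ᵥ φ x) else 1) •
        encode (de := de) p X F i
    simp only [smul_smul, ← mul_div_assoc] at this
    simp only [W, if_true, vecMul_one, this]
    rw [Finset.sum_apply, Finset.mul_sum]
    rfl
  · intro μ _ hμ
    simp [W, hμ]
  · simp

/-! ### Obstruction to approximation by message passing -/

/-- A quantity that adds up a feature over all other nodes is not approximated by message passing
networks with too few steps for information to flow from `u` to `v`. -/
theorem not_mpApproximates_of_no_walk {n dv de T : ℕ} {C : Type} {E : Finset (MIdx 2 n)}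
    {r δ κ : ℝ} (hr : 0 < r) (hδ : δ ≤ κ * r) (a : Fin dv) (c : C)
    (g : (Fin n → Fin dv → ℝ) → (Fin n → Fin n → Fin de → ℝ) → Fin n → C → ℝ)
    (hg : ∀ X F v, g X F v c = κ * ∑ u ∈ Finset.univ.erase v, X u a) {u v : Fin n}
    (h : ∀ t ≤ T, ¬ HasWalk E t u v) : ¬ MPApproximates E T r δ g := by
  classical
  rintro ⟨d, net, R, happ⟩
  have huv : u ≠ v := fun e => h 0 (Nat.zero_le T) e
  let X : ℝ → Fin n → Fin dv → ℝ := fun s w _ => if w = u then s else 0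
  have hX : ∀ s, |s| ≤ r → ∀ i c, |X s i c| ≤ r := by
    intro s hs i c
    simp only [X]
    split_ifs
    · exact hs
    · simpa using hr.le
  have hF : ∀ i j c, |(0 : Fin n → Fin n → Fin de → ℝ) i j c| ≤ r := by
    intro i j c
    simpa using hr.le
  have hgX : ∀ s, g (X s) 0 v c = κ * s := by
    intro s
    rw [hg]
    simp [X, huv]
  have h1 := happ (X r) 0 (hX r (abs_of_pos hr).le) hF v c
  have h2 := happ (X (-r)) 0 (hX (-r) (by rw [abs_neg, abs_of_pos hr])) hF v c
  -- The two inputs differ only at `u`, so the network has one value at `v` for both. It cannot be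
  -- closer than `κ * r` to both `κ * r` and `-(κ * r)`.
  rw [MPNN.eval_congr E (X' := X (-r)) 0 net v fun w t ht hw => by
    have : w ≠ u := fun e => h t ht (e ▸ hw)
    simp [X, this]] at h1
  rw [hgX] at h1 h2
  have := abs_lt.1 h1
  have := abs_lt.1 h2
  linarith

theorem exists_layer_not_mpApproximates {dH dK : ℕ} (hdH : 0 < dH)
    (φ : (Fin dH → ℝ) → Fin dK → ℝ) {x : Fin dH → ℝ} (hs : 0 < φ x ⬝ᵥ φ x) (normalized : Bool)
    (dv de p : ℕ) (hdv : 0 < dv) :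
    ∃ (H dF : ℕ) (P : EncParams 2 2 (Chan dv de p) H dH dF),
      ∀ (n : ℕ) (E : Finset (MIdx 2 n)) (r : ℝ), 0 < r →
      ∃ δ : ℝ, 0 < δ ∧
        (∀ T : ℕ, (T : ℕ∞) < diameter E →
          ¬ MPApproximates E T r δ (fun X F j =>
            P.enc φ normalized (withLoops E) (withLoops E) (encode p X F) ![j, j])) ∧
        (¬ IsConnected E → ∀ T : ℕ,
          ¬ MPApproximates E T r δ (fun X F j =>
            P.enc φ normalized (withLoops E) (withLoops E) (encode p X F) ![j, j])) := by
  obtain ⟨H, dF, P, hP⟩ :=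
    exists_layer_sum_other_nodes hdH φ x normalized dv de p ⟨0, hdv⟩
  refine ⟨H, dF, P, fun n E r hr => ?_⟩
  set s := φ x ⬝ᵥ φ x
  set κ := s / if normalized then (n - 1 : ℝ) * s else 1 with hκ
  have hκ0 : 2 ≤ n → 0 < κ := by
    intro hn
    have hn : (2 : ℝ) ≤ n := by exact_mod_cast hn
    rw [hκ]
    split_ifs
    · exact div_pos hs (mul_pos (by linarith) hs)
    · simpa using hs
  have key : ∀ T u v, (∀ t ≤ T, ¬ HasWalk E t u v) →
      ¬ MPApproximates E T r (if 2 ≤ n then κ * r else 1) (fun X F j =>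
        P.enc φ normalized (withLoops E) (withLoops E) (encode p X F) ![j, j]) := by
    intro T u v h
    have huv : u ≠ v := fun e => h 0 (Nat.zero_le T) e
    have hn : 2 ≤ n := by
      have := Fintype.one_lt_card_iff.2 ⟨u, v, huv⟩
      rwa [Fintype.card_fin] at this
    rw [if_pos hn]
    exact not_mpApproximates_of_no_walk hr le_rfl ⟨0, hdv⟩ _ _ (fun X F w => hP n E X F w) h
  -- With fewer than two nodes no pair lacks a walk, and any positive `δ` serves.
  refine ⟨if 2 ≤ n then κ * r else 1, ?_, fun T hT => ?_, fun hE T => ?_⟩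
  · split_ifs with hn
    · exact mul_pos (hκ0 hn) hr
    · exact one_pos
  · obtain ⟨u, v, h⟩ := exists_no_walk_of_lt_diameter hT
    exact key T u v h
  · simp only [IsConnected, not_forall] at hE
    obtain ⟨u, v, h⟩ := hE
    exact key T u v fun t _ hw => h hw.eqvGen

end HOT

end

theorem theorem2 (dH dK : ℕ) (hdH : 0 < dH) (φ : (Fin dH → ℝ) → Fin dK → ℝ)
    (hφ : ∀ x c, 0 ≤ φ x c) (hφ0 : ∃ x c, φ x c ≠ 0) :
    -- two layers approximate any message passing step
    (∀ (dv de dm d : ℕ) (S : HOT.MPStep dv de dm d), Continuous S.M → Continuous S.U →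
      ∀ (N : ℕ) (r ε : ℝ), 0 < ε → ∀ loops : Prop,
      ∃ (p H₁ H₂ dF₁ dF₂ : ℕ)
        (P₁ : HOT.EncParams 2 2 (HOT.Chan dv de p) H₁ dH dF₁)
        (P₂ : HOT.EncParams 2 2 (HOT.Chan dv de p) H₂ dH dF₂)
        (out : Fin d ↪ HOT.Chan dv de p),
      ∀ n ≤ N, ∀ E : Finset (HOT.MIdx 2 n), (∀ i, ![i, i] ∈ E ↔ loops) →
      ∀ (X : Fin n → Fin dv → ℝ) (F : Fin n → Fin n → Fin de → ℝ),
        (∀ i c, |X i c| ≤ r) → (∀ i j c, |F i j c| ≤ r) →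
        ∀ j c,
          |P₂.enc φ false (HOT.withLoops E) (HOT.withLoops E)
              (P₁.enc φ false (HOT.withLoops E) (HOT.withLoops E) (HOT.encode p X F))
              ![j, j] (out c)
            - S.apply E X F j c| < ε) ∧
    -- some single layer cannot be approximated by message passing
    (∀ (normalized : Bool) (dv de p : ℕ), 0 < dv →
      ∃ (H dF : ℕ) (P : HOT.EncParams 2 2 (HOT.Chan dv de p) H dH dF),
      ∀ (n : ℕ) (E : Finset (HOT.MIdx 2 n)) (r : ℝ), 0 < r →
      ∃ δ : ℝ, 0 < δ ∧
        (∀ T : ℕ, (T : ℕ∞) < HOT.diameter E →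
          ¬ HOT.MPApproximates E T r δ (fun X F j =>
            P.enc φ normalized (HOT.withLoops E) (HOT.withLoops E) (HOT.encode p X F) ![j, j])) ∧
        (¬ HOT.IsConnected E → ∀ T : ℕ,
          ¬ HOT.MPApproximates E T r δ (fun X F j =>
            P.enc φ normalized (HOT.withLoops E) (HOT.withLoops E)
              (HOT.encode p X F) ![j, j]))) := by
  obtain ⟨x, c, hxc⟩ := hφ0
  -- This `x` is the constant query and key of all layers constructed above.
  have hs : 0 < φ x ⬝ᵥ φ x := Finset.sum_pos' (fun c _ => mul_nonneg (hφ x c) (hφ x c))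
    ⟨c, Finset.mem_univ c, mul_self_pos.2 hxc⟩
  exact ⟨fun _ _ _ _ S hM hU N r ε hε loops =>
      HOT.exists_layers_approximating_step hdH φ hs.ne' S hM hU N r ε hε loops,
    fun normalized dv de p hdv =>
      HOT.exists_layer_not_mpApproximates hdH φ hs normalized dv de p hdv⟩
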